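/- Let $1\le k\le n$, let $A$ be a complex $n\times n$ matrix, and let $H$ be a complex Hilbert space with orthonormal basis $e_1,\dots,e_n$; an $n\times n$ matrix is identified with the operator on $H$ that it represents in this basis. For $0\le m\le n$ let $Q_{m,n}$ be the set of strictly increasing $m$-tuples in $\{1,\dots,n\}$, let $\vee^m H$ be the space of symmetric tensors in $\otimes^m H$, with the inner product inherited from $\otimes^m H$, let $e_I=(m!)^{-1/2}\sum_{\sigma\in S_m}e_{i_{\sigma(1)}}\otimes\cdots\otimes e_{i_{\sigma(m)}}$ for $I=(i_1,\dots,i_m)\in Q_{m,n}$, and let $P_m$ be the orthogonal projection of $\vee^m H$ onto the span of $\{e_I: I\in Q_{m,n}\}$. For an operator $T$ on $\vee^m H$ regard $P_mTP_m$ as the $\binom nm\times\binom nm$ matrix $(\langle e_I,P_mTP_me_J\rangle)_{I,J\in Q_{m,n}}$. For operators $X^1,\dots,X^k$ on $H$ let $X^1\vee\cdots\vee X^k$ be the restriction of $\frac1{k!}\sum_{\sigma\in S_k}X^{\sigma(1)}\otimes\cdots\otimes X^{\sigma(k)}$ to $\vee^kH$, and let $\vee^m X$ be the restriction of $X\otimes\cdots\otimes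 X$ ($m$ factors) to $\vee^m H$. For $I,J\in Q_{k,n}$ let $A(I|J)$ be the matrix obtained from $A$ by deleting the rows $I$ and the columns $J$. Identify the index set $Q_{n-k,n}$ with $Q_{k,n}$ by any fixed bijection, and let $\tilde\vee^{n-k}A$ be any operator on $\vee^{n-k}H$ for which the matrix $P_{n-k}(\tilde\vee^{n-k}A)P_{n-k}$, indexed through this bijection by $Q_{k,n}$, is the transpose of $(\operatorname{per}A(I|J))_{I,J\in Q_{k,n}}$. Such operators exist for every bijection; if the bijection is $I\mapsto\{1,\dots,n\}\setminus I$, then $\vee^{n-k}(A^T)$ is one. The function $\operatorname{per}$ is smooth on the complex $n\times n$ matrices, and for all complex $n\times n$ matrices $X^1,\dots,X^k$ its $k$-th derivative satisfies $$D^k\operatorname{per}(A)(X^1,\dots,X^k)=k!\,\operatorname{tr}\big[(P_{n-k}(\tilde\vee^{n-k}A)P_{n-k})(P_k(X^1\vee\cdots\vee X^k)P_k)\big].$$ In particular, for every complex $n\times n$ matrix $X$, $$D^k\operatorname{per}(A)(X,\dots,X)=k!\,\operatorname{tr}\big[(P_{n-k}(\tilde\vee^{n-k}A)P_{n-k})(P_k(\vee^kX)P_k)\big].$$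 Moreover $D\operatorname{per}(A)(X)=\operatorname{tr}(\operatorname{padj}(A)^TX)$, where $\operatorname{padj}(A)$ is the matrix whose $(i,j)$ entry is $\operatorname{per}A(i|j)$. -/

import Mathlib

open scoped TensorProduct Nat ContDiff InnerProductSpace Matrix.Norms.L2Operator

noncomputable section

namespace PermDeriv

/-! ### Index sets and permanental minors -/

/-- `Q k n`: the strictly increasing `k`-tuples of indices in `Fin n`; such a tuple is recorded by
the `k`-element set of its entries, see `Q.tuple`. -/
abbrev Q (k n : ℕ) : Type := {s : Finset (Fin n) // s.card = k}

/-- The increasing tuple `i_1 < ⋯ < i_k` given by an element of `Q k n`. -/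
def Q.tuple {k n : ℕ} (I : Q k n) : Fin k → Fin n := I.1.orderEmbOfFin I.2

/-- The complementary set of indices. -/
def Q.compl {k n : ℕ} (I : Q k n) : Q (n - k) n :=
  ⟨I.1ᶜ, by rw [Finset.card_compl, Fintype.card_fin, I.2]⟩

/-- Complementation, as a bijection from `Q k n` to `Q (n - k) n`. -/
def Q.complEquiv {k n : ℕ} (hk : k ≤ n) : Q k n ≃ Q (n - k) n where
  toFun := Q.compl
  invFun J := ⟨J.1ᶜ, by rw [Finset.card_compl, Fintype.card_fin, J.2]; omega⟩
  left_inv I := Subtype.ext (compl_compl I.1)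
  right_inv J := Subtype.ext (compl_compl J.1)

/-- `A(I|J)`: the matrix obtained from `A` by deleting the rows `I` and the columns `J`. -/
def deleted {k n : ℕ} (A : Matrix (Fin n) (Fin n) ℂ) (I J : Q k n) :
    Matrix (Fin (n - k)) (Fin (n - k)) ℂ :=
  A.submatrix I.compl.tuple J.compl.tuple

/-- The permanental adjoint: its `(i, j)` entry is `per A(i|j)`. -/
def padj {n : ℕ} (A : Matrix (Fin n) (Fin n) ℂ) : Matrix (Fin n) (Fin n) ℂ :=
  Matrix.of fun i j => (deleted (k := 1) A ⟨{i}, Finset.card_singleton i⟩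
    ⟨{j}, Finset.card_singleton j⟩).permanent

/-! ### Symmetric tensors and their inner product -/

section

variable (k : ℕ) (H : Type*) [NormedAddCommGroup H] [InnerProductSpace ℂ H]

/-- The subspace of symmetric tensors of the `k`-fold tensor power of `H`: those fixed by every
permutation of the factors. -/
def symTensors : Submodule ℂ (⨂[ℂ] _ : Fin k, H) where
  carrier := {u | ∀ σ : Equiv.Perm (Fin k), PiTensorProduct.reindex ℂ (fun _ => H) σ u = u}
  add_mem' {u v} hu hv σ := by rw [map_add, hu σ, hv σ]
  zero_mem' σ := map_zero _
  smul_mem' c u hu σ := by rw [map_smul, hu σ]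

/-- The symmetric tensor power `∨^k H`. (A separate name for the type of symmetric tensors, which
carries the Hilbert space norm below, and not the injective tensor norm.) -/
def SymPow : Type _ := symTensors k H

instance : AddCommGroup (SymPow k H) := inferInstanceAs (AddCommGroup (symTensors k H))

instance : Module ℂ (SymPow k H) := inferInstanceAs (Module ℂ (symTensors k H))

variable [FiniteDimensional ℂ H]

/-- A basis of the tensor power, made of the pure tensors of an orthonormal basis of `H`. -/
def tensorBasis : Module.Basis (Fin k → Fin (Module.finrank ℂ H)) ℂ (⨂[ℂ] _ : Fin k, H) :=
  Basis.piTensorProduct (fun _ => (stdOrthonormalBasis ℂ H).toBasis)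

/-- The Hilbert space inner product of the tensor power. It is defined through a basis, but
`tensorInner_tprod` shows that it does not depend on it. -/
def tensorInner (u v : ⨂[ℂ] _ : Fin k, H) : ℂ :=
  ∑ p, star ((tensorBasis k H).repr u p) * (tensorBasis k H).repr v p

theorem tensorInner_tprod (x y : Fin k → H) :
    tensorInner k H (PiTensorProduct.tprod ℂ x) (PiTensorProduct.tprod ℂ y) =
      ∏ i, ⟪x i, y i⟫_ℂ := by
  simp only [tensorInner, tensorBasis, Basis.piTensorProduct_repr_tprod_apply, star_prod,
    ← Finset.prod_mul_distrib]
  rw [← Fintype.prod_sum (fun i j =>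
    star ((stdOrthonormalBasis ℂ H).toBasis.repr (x i) j) *
      (stdOrthonormalBasis ℂ H).toBasis.repr (y i) j)]
  refine Finset.prod_congr rfl fun i _ => ?_
  rw [← (stdOrthonormalBasis ℂ H).sum_inner_mul_inner (x i) (y i)]
  refine Finset.sum_congr rfl fun j _ => ?_
  simp [OrthonormalBasis.repr_apply_apply]

/-- The inner product of `∨^k H` is that of the tensor power. -/
abbrev symPowCore : InnerProductSpace.Core ℂ (SymPow k H) where
  inner u v := tensorInner k H u.1 v.1
  conj_inner_symm u v := by
    simp [tensorInner, mul_comm]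
  re_inner_nonneg u := by
    simp only [tensorInner, map_sum]
    refine Finset.sum_nonneg fun p _ => ?_
    simp [← Complex.normSq_eq_conj_mul_self, Complex.normSq_nonneg]
  add_left u v w := by
    have h : (u + v).1 = u.1 + v.1 := rfl
    simp [tensorInner, h, add_mul, Finset.sum_add_distrib]
  smul_left u v c := by
    have h : (c • u).1 = c • u.1 := rfl
    simp [tensorInner, h, Finset.mul_sum, mul_assoc]
  definite u hu := by
    have h0 : ∑ p, Complex.normSq ((tensorBasis k H).repr u.1 p) = 0 := by
      have := congrArg Complex.re hu
      simpa [tensorInner, Complex.normSq_apply] using this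
    rw [Finset.sum_eq_zero_iff_of_nonneg (fun _ _ => Complex.normSq_nonneg _)] at h0
    refine Subtype.ext ((tensorBasis k H).repr.injective ?_)
    ext p
    have h1 : (tensorBasis k H).repr u.1 p = 0 := by simpa using h0 p (Finset.mem_univ p)
    have h2 : (0 : SymPow k H).1 = 0 := rfl
    simp [h1, h2]

instance : NormedAddCommGroup (SymPow k H) := (symPowCore k H).toNormedAddCommGroup

instance : InnerProductSpace ℂ (SymPow k H) := InnerProductSpace.ofCore (symPowCore k H).toCore

instance : FiniteDimensional ℂ (SymPow k H) :=
  inferInstanceAs (FiniteDimensional ℂ (symTensors k H))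

end

section

variable {k : ℕ} {H : Type*} [NormedAddCommGroup H] [InnerProductSpace ℂ H]

theorem sum_tprod_mem (x : Fin k → H) :
    ∑ σ : Equiv.Perm (Fin k), PiTensorProduct.tprod ℂ (fun i => x (σ i)) ∈ symTensors k H := by
  intro τ
  rw [map_sum]
  refine Fintype.sum_equiv (Equiv.mulRight τ⁻¹) _ _ fun σ => ?_
  exact PiTensorProduct.reindex_tprod τ _

/-- `x_1 ∨ ⋯ ∨ x_k = (k!)^{-1/2} ∑_σ x_{σ(1)} ⊗ ⋯ ⊗ x_{σ(k)}`. -/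
def symTensor (x : Fin k → H) : SymPow k H :=
  ⟨(((Real.sqrt (k ! : ℝ))⁻¹ : ℝ) : ℂ) •
      ∑ σ : Equiv.Perm (Fin k), PiTensorProduct.tprod ℂ (fun i => x (σ i)),
    (symTensors k H).smul_mem _ (sum_tprod_mem x)⟩

/-! ### Operators on the symmetric tensor power -/

/-- The operator `(1/k!) ∑_σ X^{σ(1)} ⊗ ⋯ ⊗ X^{σ(k)}` on the `k`-fold tensor power. -/
def tensorSymm (X : Fin k → H →ₗ[ℂ] H) : (⨂[ℂ] _ : Fin k, H) →ₗ[ℂ] (⨂[ℂ] _ : Fin k, H) :=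
  ((k ! : ℂ)⁻¹) • ∑ σ : Equiv.Perm (Fin k), PiTensorProduct.map (fun i => X (σ i))

theorem tensorSymm_mem (X : Fin k → H →ₗ[ℂ] H) :
    ∀ u ∈ symTensors k H, tensorSymm X u ∈ symTensors k H := by
  intro u hu τ
  simp only [tensorSymm, LinearMap.smul_apply, LinearMap.sum_apply, map_smul, map_sum]
  congr 1
  refine Fintype.sum_equiv (Equiv.mulRight τ⁻¹) _ _ fun σ => ?_
  have h := PiTensorProduct.map_reindex (R := ℂ) (fun i => X (σ i)) τ u
  rw [← h, hu τ]
  rfl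

/-- `X^1 ∨ ⋯ ∨ X^k`: the restriction of `tensorSymm X` to the symmetric tensor power. -/
def symOp (X : Fin k → H →ₗ[ℂ] H) : SymPow k H →ₗ[ℂ] SymPow k H :=
  (tensorSymm X).restrict (tensorSymm_mem X)

theorem map_mem (X : H →ₗ[ℂ] H) :
    ∀ u ∈ symTensors k H, PiTensorProduct.map (fun _ => X) u ∈ symTensors k H := by
  intro u hu τ
  have h := PiTensorProduct.map_reindex (R := ℂ) (fun _ : Fin k => X) τ u
  rw [← h, hu τ]

/-- `∨^k X`: the restriction of `X ⊗ ⋯ ⊗ X` to the symmetric tensor power. -/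
def symPowOp (k : ℕ) (X : H →ₗ[ℂ] H) : SymPow k H →ₗ[ℂ] SymPow k H :=
  (PiTensorProduct.map (fun _ : Fin k => X)).restrict (map_mem X)

/-! ### Compressions -/

variable {n : ℕ}

/-- The operator on `H` with matrix `A` in the orthonormal basis `e`. -/
def op (e : OrthonormalBasis (Fin n) ℂ H) (A : Matrix (Fin n) (Fin n) ℂ) : H →ₗ[ℂ] H :=
  Matrix.toLin e.toBasis e.toBasis A

/-- `e_I = e_{i_1} ∨ ⋯ ∨ e_{i_k}`. -/
def eQ (e : OrthonormalBasis (Fin n) ℂ H) (I : Q k n) : SymPow k H :=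
  symTensor (fun r => e (I.tuple r))

variable [FiniteDimensional ℂ H]

/-- `P_k`: the orthogonal projection of `∨^k H` onto the span of the `e_I`, `I` in `Q k n`. -/
def proj (k : ℕ) (e : OrthonormalBasis (Fin n) ℂ H) : SymPow k H →ₗ[ℂ] SymPow k H :=
  (Submodule.span ℂ (Set.range (eQ (k := k) e))).starProjection.toLinearMap

/-- The compression `P_k T P_k`, as a matrix with respect to the vectors `e_I`, `I` in `Q k n`. -/
def compress (e : OrthonormalBasis (Fin n) ℂ H) (T : SymPow k H →ₗ[ℂ] SymPow k H) :
    Matrix (Q k n) (Q k n) ℂ :=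
  Matrix.of fun I J => ⟪eQ e I, (proj k e ∘ₗ T ∘ₗ proj k e) (eQ e J)⟫_ℂ

/-- With `Q (n - k) n` identified with `Q k n` through `ι`, the compression of the operator `T` on
`∨^{n-k} H` is the transpose of the matrix whose `(I, J)` entry is `per A(I|J)`. -/
def IsPermMinorOp (e : OrthonormalBasis (Fin n) ℂ H) (ι : Q k n ≃ Q (n - k) n)
    (A : Matrix (Fin n) (Fin n) ℂ) (T : SymPow (n - k) H →ₗ[ℂ] SymPow (n - k) H) : Prop :=
  (compress e T).submatrix ι ι =
    (Matrix.of fun I J : Q k n => (deleted A I J).permanent).transpose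

end

end PermDeriv

end

/-!
# Derivatives of the permanent and compressions of symmetric tensor powers

Both sides of the trace formula equal the same sum over pairs `I, J` of `k`-sets,
`∑ I, ∑ J, per A(I|J) * ∑ ρ, ∑ τ, ∏ r, X r (i_{ρ r}) (j_{τ r})`, with `ρ, τ` in `S_k`.

For the derivative (`iteratedFDeriv_permanent_eq_sum_minors`), the permanent is a multilinear
function of the columns, so its `k`-th derivative is the sum, over the injective `k`-tuples `q` of
column indices, of the permanent of `A` with column `q r` replaced by that of `X r`. The
permutations `σ` in such a permanent are grouped according to the tuple `p = σ ∘ q` of rows: the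
entries of the `X r` depend on `p` and `q` only, and the sum of the remaining factors over all `σ`
with `σ ∘ q = p` is the permanent of `A` with the rows `p` and columns `q` deleted
(`sum_perm_filter_eq_permanent`). An injective tuple is a `k`-set together with a permutation
(`Q.embedding_bijective`).

For the trace, the matrix entries of `P_k (X^1 ∨ ⋯ ∨ X^k) P_k` are `(k!)⁻¹` times the inner double
sum (`compress_symOp_apply`), by the formula for the inner product of pure tensors. Specialized to
equal operators, this computes the entries of `P_m (∨^m X) P_m` as the permanents of the submatrices
of `X` (`compress_symPowOp_apply`). For `X = Aᵀ` this identifies `∨^{n-k} Aᵀ`, and for `X = 1` it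
gives the orthonormality of the `e_I`, by which every matrix is a compression.
-/

open scoped TensorProduct Nat ContDiff InnerProductSpace Matrix.Norms.L2Operator

noncomputable section

namespace PermDeriv

/-! ### Injective tuples of indices -/

section Tuples

variable {k n : ℕ}

theorem Q.tuple_injective (I : Q k n) : Function.Injective I.tuple :=
  (I.1.orderEmbOfFin I.2).injective

theorem Q.range_tuple (I : Q k n) : Set.range I.tuple = I.1 :=
  Finset.range_orderEmbOfFin I.1 I.2

theorem Q.tuple_mem (I : Q k n) (r : Fin k) : I.tuple r ∈ I.1 :=
  Finset.orderEmbOfFin_mem I.1 I.2 r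

/-- The injective tuple obtained by permuting the entries of the increasing tuple `I` by `ρ`. -/
def Q.embedding (I : Q k n) (ρ : Equiv.Perm (Fin k)) : Fin k ↪ Fin n :=
  ρ.toEmbedding.trans (I.1.orderEmbOfFin I.2).toEmbedding

@[simp]
theorem Q.embedding_apply (I : Q k n) (ρ : Equiv.Perm (Fin k)) (r : Fin k) :
    I.embedding ρ r = I.tuple (ρ r) := rfl

theorem Q.range_embedding (I : Q k n) (ρ : Equiv.Perm (Fin k)) :
    Set.range (I.embedding ρ) = I.1 := by
  rw [← I.range_tuple]
  exact ρ.surjective.range_comp I.tuple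

/-- An injective tuple is an increasing tuple followed by a permutation, in a unique way. -/
theorem Q.embedding_bijective :
    Function.Bijective fun x : Q k n × Equiv.Perm (Fin k) => x.1.embedding x.2 := by
  constructor
  · rintro ⟨I, ρ⟩ ⟨J, τ⟩ h
    have h : I.embedding ρ = J.embedding τ := h
    obtain rfl : I = J := by
      refine Subtype.ext (Finset.coe_injective ?_)
      rw [← I.range_embedding ρ, h, J.range_embedding]
    congr 1
    ext1 r
    exact I.tuple_injective (DFunLike.congr_fun h r)
  · intro q
    let I : Q k n := ⟨Finset.univ.map q, by simp⟩
    have hq (r : Fin k) : ∃ s, I.tuple s = q r := by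
      have : q r ∈ Set.range I.tuple := by simp [I.range_tuple, I]
      exact this
    choose f hf using hq
    have hinj : Function.Injective f := fun r s h => q.injective (by rw [← hf, ← hf, h])
    exact ⟨(I, Equiv.ofBijective f (Finite.injective_iff_bijective.1 hinj)),
      DFunLike.ext _ _ hf⟩

/-- The enumeration of `Fin n` that lists the increasing tuple `I`, permuted by `ρ`, and then the
complementary increasing tuple. -/
def Q.enum (I : Q k n) (ρ : Equiv.Perm (Fin k)) : Fin k ⊕ Fin (n - k) ≃ Fin n :=
  Equiv.ofBijective (Sum.elim (I.embedding ρ) I.compl.tuple) <| by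
    constructor
    · refine (I.embedding ρ).injective.sumElim I.compl.tuple_injective fun r m h => ?_
      have h2 := I.compl.tuple_mem m
      rw [← h] at h2
      exact (Finset.mem_compl.1 h2) (I.tuple_mem (ρ r))
    · rw [← Set.range_eq_univ, Set.Sum.elim_range, I.range_embedding, I.compl.range_tuple]
      ext i
      simp [Q.compl]

@[simp]
theorem Q.enum_inl (I : Q k n) (ρ : Equiv.Perm (Fin k)) (r : Fin k) :
    I.enum ρ (Sum.inl r) = I.tuple (ρ r) := rfl

@[simp]
theorem Q.enum_inr (I : Q k n) (ρ : Equiv.Perm (Fin k)) (m : Fin (n - k)) :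
    I.enum ρ (Sum.inr m) = I.compl.tuple m := rfl

@[simp]
theorem Q.enum_symm_tuple (I : Q k n) (ρ : Equiv.Perm (Fin k)) (r : Fin k) :
    (I.enum ρ).symm (I.tuple (ρ r)) = Sum.inl r := by
  rw [Equiv.symm_apply_eq, I.enum_inl]

@[simp]
theorem Q.enum_symm_compl_tuple (I : Q k n) (ρ : Equiv.Perm (Fin k)) (m : Fin (n - k)) :
    (I.enum ρ).symm (I.compl.tuple m) = Sum.inr m := by
  rw [Equiv.symm_apply_eq, I.enum_inr]

/-- The permutations of `Fin n` that carry the tuple `J.embedding τ` to the tuple `I.embedding ρ`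
correspond to the bijections between the complements, whence a permanental minor. -/
theorem sum_perm_filter_eq_permanent (A : Matrix (Fin n) (Fin n) ℂ) (I J : Q k n)
    (ρ τ : Equiv.Perm (Fin k)) :
    ∑ σ : Equiv.Perm (Fin n) with (J.embedding τ).trans σ.toEmbedding = I.embedding ρ,
      ∏ m, A (σ (J.compl.tuple m)) (J.compl.tuple m) = (deleted A I J).permanent := by
  symm
  refine Finset.sum_bij
    (fun π _ => ((J.enum τ).symm.trans (Equiv.Perm.sumCongr 1 π)).trans (I.enum ρ)) ?_ ?_ ?_ ?_
  · intro π _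
    rw [Finset.mem_filter]
    refine ⟨Finset.mem_univ _, ?_⟩
    ext1 r
    simp
  · intro π _ π' _ h
    ext1 m
    have := Equiv.congr_fun h (J.enum τ (Sum.inr m))
    simpa [I.compl.tuple_injective.eq_iff] using this
  · intro σ hσ
    have hσ := (Finset.mem_filter.1 hσ).2
    -- Read through the two enumerations, `σ` fixes the first block pointwise, so it is given by a
    -- permutation of the second.
    let π : Equiv.Perm (Fin k ⊕ Fin (n - k)) := ((J.enum τ).trans σ).trans (I.enum ρ).symm
    have hπ (r : Fin k) : π (Sum.inl r) = Sum.inl r := by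
      have := DFunLike.congr_fun hσ r
      simp only [π, Equiv.trans_apply, Equiv.symm_apply_eq]
      exact this
    obtain ⟨⟨α, β⟩, hαβ⟩ := Equiv.Perm.mem_sumCongrHom_range_of_perm_mapsTo_inl (σ := π)
      (by rintro _ ⟨r, rfl⟩; exact ⟨r, (hπ r).symm⟩)
    refine ⟨β, Finset.mem_univ _, ?_⟩
    ext1 i
    obtain ⟨x, rfl⟩ := (J.enum τ).surjective i
    have hx : Equiv.Perm.sumCongr 1 β x = π x := by
      cases x with
      | inl r => rw [hπ]; simp
      | inr m => rw [← hαβ]; simp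
    simp only [Equiv.trans_apply, Equiv.symm_apply_apply, hx]
    simp [π]
  · intro π _
    exact Finset.prod_congr rfl fun m _ => by simp [deleted]

end Tuples

/-! ### Derivatives of the permanent -/

section Derivative

variable {k n : ℕ}

/-- The permanent, as a continuous multilinear function of the columns. -/
def permMultilinear (n : ℕ) : ContinuousMultilinearMap ℂ (fun _ : Fin n => Fin n → ℂ) ℂ :=
  ∑ σ : Equiv.Perm (Fin n),
    (ContinuousMultilinearMap.mkPiAlgebra ℂ (Fin n) ℂ).compContinuousLinearMap
      fun i => ContinuousLinearMap.proj (σ i)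

theorem permMultilinear_apply (c : Fin n → Fin n → ℂ) :
    permMultilinear n c = ∑ σ : Equiv.Perm (Fin n), ∏ i, c i (σ i) := by
  simp [permMultilinear]

/-- The columns of a matrix, as a continuous linear map. -/
def columns (n : ℕ) : Matrix (Fin n) (Fin n) ℂ →L[ℂ] (Fin n → Fin n → ℂ) :=
  LinearMap.toContinuousLinearMap
    { toFun := fun M i j => M j i
      map_add' := fun _ _ => rfl
      map_smul' := fun _ _ => rfl }

@[simp]
theorem columns_apply (M : Matrix (Fin n) (Fin n) ℂ) (i j : Fin n) : columns n M i j = M j i := rfl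

theorem permanent_eq_comp_columns :
    (fun M : Matrix (Fin n) (Fin n) ℂ => M.permanent) = permMultilinear n ∘ columns n := by
  ext M
  simp [permMultilinear_apply, Matrix.permanent]

theorem contDiff_permanent {m : WithTop ℕ∞} :
    ContDiff ℂ m (fun M : Matrix (Fin n) (Fin n) ℂ => M.permanent) := by
  rw [permanent_eq_comp_columns]
  exact (permMultilinear n).contDiff.comp (columns n).contDiff

/-- The derivative of order `k` of the permanent replaces, in every possible way, `k` columns of
`A` by the corresponding columns of the matrices `X r`. -/
theorem iteratedFDeriv_permanent (A : Matrix (Fin n) (Fin n) ℂ)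
    (X : Fin k → Matrix (Fin n) (Fin n) ℂ) :
    iteratedFDeriv ℂ k (fun M : Matrix (Fin n) (Fin n) ℂ => M.permanent) A X =
      ∑ y : Q k n × Equiv.Perm (Fin k), ∑ σ : Equiv.Perm (Fin n),
        (∏ r, X r (σ (y.1.tuple (y.2 r))) (y.1.tuple (y.2 r))) *
          ∏ m, A (σ (y.1.compl.tuple m)) (y.1.compl.tuple m) := by
  rw [permanent_eq_comp_columns, (columns n).iteratedFDeriv_comp_right
    (permMultilinear n).contDiff A (le_top (a := ((k : ℕ) : WithTop ℕ∞))),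
    ContinuousMultilinearMap.iteratedFDeriv_eq]
  simp only [ContinuousMultilinearMap.compContinuousLinearMap_apply,
    ContinuousMultilinearMap.iteratedFDeriv, sum_apply]
  rw [← (Equiv.ofBijective _ (Q.embedding_bijective (k := k) (n := n))).sum_comp]
  refine Finset.sum_congr rfl fun ⟨J, τ⟩ _ => ?_
  simp only [Equiv.ofBijective_apply, ContinuousMultilinearMap.iteratedFDerivComponent_apply,
    permMultilinear_apply]
  refine Finset.sum_congr rfl fun σ _ => ?_
  rw [← (J.enum τ).prod_comp, Fintype.prod_sum_type]
  congr 1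
  · refine Finset.prod_congr rfl fun r _ => ?_
    have h : J.tuple (τ r) ∈ Set.range (J.embedding τ) := ⟨r, rfl⟩
    rw [J.enum_inl, dif_pos h]
    refine congrArg (fun s => X s (σ (J.tuple (τ r))) (J.tuple (τ r))) ?_
    rw [Equiv.symm_apply_eq]
    rfl
  · refine Finset.prod_congr rfl fun m _ => ?_
    have h : J.compl.tuple m ∉ Set.range (J.embedding τ) := by
      rw [J.range_embedding]
      exact Finset.mem_compl.1 (J.compl.tuple_mem m)
    rw [J.enum_inr, dif_neg h]
    rfl

/-- The coordinate form of the derivative: each pair of `k`-sets of rows and columns contributes a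
permanental minor of `A` times a mixed permanent of the corresponding blocks of the `X r`. -/
theorem iteratedFDeriv_permanent_eq_sum_minors (A : Matrix (Fin n) (Fin n) ℂ)
    (X : Fin k → Matrix (Fin n) (Fin n) ℂ) :
    iteratedFDeriv ℂ k (fun M : Matrix (Fin n) (Fin n) ℂ => M.permanent) A X =
      ∑ J : Q k n, ∑ I : Q k n, (deleted A I J).permanent *
        ∑ ρ : Equiv.Perm (Fin k), ∑ τ : Equiv.Perm (Fin k),
          ∏ r, X r (I.tuple (ρ r)) (J.tuple (τ r)) := by
  have key (J : Q k n) (τ : Equiv.Perm (Fin k)) : ∑ σ : Equiv.Perm (Fin n),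
        (∏ r, X r (σ (J.tuple (τ r))) (J.tuple (τ r))) *
          ∏ m, A (σ (J.compl.tuple m)) (J.compl.tuple m) =
      ∑ I : Q k n, ∑ ρ : Equiv.Perm (Fin k), (deleted A I J).permanent *
        ∏ r, X r (I.tuple (ρ r)) (J.tuple (τ r)) := by
    rw [← Finset.sum_fiberwise _ fun σ : Equiv.Perm (Fin n) =>
        (J.embedding τ).trans σ.toEmbedding,
      ← (Equiv.ofBijective _ (Q.embedding_bijective (k := k) (n := n))).sum_comp,
      Fintype.sum_prod_type]
    refine Finset.sum_congr rfl fun I _ => Finset.sum_congr rfl fun ρ _ => ?_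
    rw [← sum_perm_filter_eq_permanent A I J ρ τ, Finset.sum_mul]
    refine Finset.sum_congr rfl fun σ hσ => ?_
    rw [mul_comm]
    congr 1
    refine Finset.prod_congr rfl fun r _ => ?_
    have : σ (J.tuple (τ r)) = I.tuple (ρ r) :=
      DFunLike.congr_fun (Finset.mem_filter.1 hσ).2 r
    rw [this]
  rw [iteratedFDeriv_permanent, Fintype.sum_prod_type]
  refine Finset.sum_congr rfl fun J _ => ?_
  simp only [key]
  rw [Finset.sum_comm]
  refine Finset.sum_congr rfl fun I _ => ?_
  rw [Finset.sum_comm, Finset.mul_sum]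
  exact Finset.sum_congr rfl fun ρ _ => (Finset.mul_sum _ _ _).symm

end Derivative

/-! ### Compressions in coordinates -/

section Compression

variable {k n : ℕ} {H : Type*} [NormedAddCommGroup H] [InnerProductSpace ℂ H]

/-- The square of the normalizing factor of `symTensor`. -/
theorem inv_sqrt_factorial_mul_self (k : ℕ) :
    (((Real.sqrt (k ! : ℝ))⁻¹ : ℝ) : ℂ) * (((Real.sqrt (k ! : ℝ))⁻¹ : ℝ) : ℂ) = (k ! : ℂ)⁻¹ := by
  rw [← Complex.ofReal_mul, ← mul_inv, Real.mul_self_sqrt (by positivity)]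
  simp

/-- Summing over both permutations counts each term of the permanent `k!` times. -/
theorem sum_perm_sum_perm_prod (M : Matrix (Fin k) (Fin k) ℂ) :
    ∑ ρ : Equiv.Perm (Fin k), ∑ τ : Equiv.Perm (Fin k), ∏ r, M (ρ r) (τ r) =
      (k ! : ℂ) * M.permanent := by
  have h (τ : Equiv.Perm (Fin k)) :
      ∑ ρ : Equiv.Perm (Fin k), ∏ r, M (ρ r) (τ r) = M.permanent := by
    refine Fintype.sum_equiv (Equiv.mulRight τ⁻¹) _ _ fun ρ => ?_
    exact Fintype.prod_equiv τ _ _ fun r => by simp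
  rw [Finset.sum_comm, Finset.sum_congr rfl fun τ _ => h τ]
  simp [Fintype.card_perm]

theorem inner_op (e : OrthonormalBasis (Fin n) ℂ H) (X : Matrix (Fin n) (Fin n) ℂ) (i j : Fin n) :
    ⟪e i, op e X (e j)⟫_ℂ = X i j := by
  have h : op e X (e j) = ∑ l, X l j • e l := by
    simpa only [e.coe_toBasis, op] using Matrix.toLin_self e.toBasis e.toBasis X j
  simp [h, e.inner_eq_ite]

theorem symPowOp_eq_symOp (X : H →ₗ[ℂ] H) : symPowOp k X = symOp fun _ => X := by
  have hk : (k ! : ℂ) ≠ 0 := by exact_mod_cast k.factorial_ne_zero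
  ext u
  refine Subtype.ext ?_
  change PiTensorProduct.map (fun _ => X) u.1 = tensorSymm (fun _ => X) u.1
  simp [tensorSymm, Fintype.card_perm, ← Nat.cast_smul_eq_nsmul ℂ, smul_smul, hk]

theorem symPowOp_id : symPowOp k (LinearMap.id : H →ₗ[ℂ] H) = LinearMap.id := by
  ext u
  refine Subtype.ext ?_
  change PiTensorProduct.map (fun _ => LinearMap.id) u.1 = u.1
  rw [PiTensorProduct.map_id]
  rfl

variable [FiniteDimensional ℂ H]

theorem SymPow.inner_def (u v : SymPow k H) : ⟪u, v⟫_ℂ = tensorInner k H u.1 v.1 := rfl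

/-- The projections in the definition of a compression do not affect its matrix, since they fix the
`e_I`. -/
theorem compress_apply (e : OrthonormalBasis (Fin n) ℂ H) (T : SymPow k H →ₗ[ℂ] SymPow k H)
    (I J : Q k n) : compress e T I J = ⟪eQ e I, T (eQ e J)⟫_ℂ := by
  have hmem (I : Q k n) : eQ e I ∈ Submodule.span ℂ (Set.range (eQ (k := k) e)) :=
    Submodule.subset_span ⟨I, rfl⟩
  have hproj (I : Q k n) : proj k e (eQ e I) = eQ e I :=
    Submodule.starProjection_eq_self_iff.2 (hmem I)
  simp only [compress, Matrix.of_apply, LinearMap.comp_apply, hproj]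
  conv_rhs => rw [← hproj I]
  exact (Submodule.inner_starProjection_left_eq_right _ _ _).symm

theorem tensorInner_smul_right (c : ℂ) (u v : ⨂[ℂ] _ : Fin k, H) :
    tensorInner k H u (c • v) = c * tensorInner k H u v := by
  simp [tensorInner, Finset.mul_sum, mul_left_comm]

theorem tensorInner_smul_left (c : ℂ) (u v : ⨂[ℂ] _ : Fin k, H) :
    tensorInner k H (c • u) v = star c * tensorInner k H u v := by
  simp [tensorInner, Finset.mul_sum, mul_assoc]

theorem tensorInner_sum_right {ι : Type*} [Fintype ι] (u : ⨂[ℂ] _ : Fin k, H)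
    (v : ι → ⨂[ℂ] _ : Fin k, H) :
    tensorInner k H u (∑ i, v i) = ∑ i, tensorInner k H u (v i) := by
  simp only [tensorInner, map_sum, Finsupp.coe_finsetSum, Finset.sum_apply, Finset.mul_sum]
  exact Finset.sum_comm

theorem tensorInner_sum_left {ι : Type*} [Fintype ι] (u : ι → ⨂[ℂ] _ : Fin k, H)
    (v : ⨂[ℂ] _ : Fin k, H) :
    tensorInner k H (∑ i, u i) v = ∑ i, tensorInner k H (u i) v := by
  simp only [tensorInner, map_sum, Finsupp.coe_finsetSum, Finset.sum_apply, star_sum,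
    Finset.sum_mul]
  exact Finset.sum_comm

/-- Averaging over the permutations of the operators changes nothing, because the two tensors are
already symmetrized. -/
theorem compress_symOp_apply (e : OrthonormalBasis (Fin n) ℂ H)
    (X : Fin k → Matrix (Fin n) (Fin n) ℂ) (I J : Q k n) :
    compress e (symOp fun i => op e (X i)) I J =
      (k ! : ℂ)⁻¹ * ∑ ρ : Equiv.Perm (Fin k), ∑ τ : Equiv.Perm (Fin k),
        ∏ r, X r (I.tuple (ρ r)) (J.tuple (τ r)) := by
  have hval : (symOp (fun i => op e (X i)) (eQ e J)).1 =
      tensorSymm (fun i => op e (X i)) (eQ e J).1 := rfl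
  -- A permutation of the operators is absorbed by reindexing the factors and both sums.
  have hπ (π : Equiv.Perm (Fin k)) : (∑ τ : Equiv.Perm (Fin k), ∑ ρ : Equiv.Perm (Fin k),
        ∏ r, X (π r) (I.tuple (ρ r)) (J.tuple (τ r))) =
      ∑ ρ : Equiv.Perm (Fin k), ∑ τ : Equiv.Perm (Fin k),
        ∏ r, X r (I.tuple (ρ r)) (J.tuple (τ r)) := by
    rw [Finset.sum_comm]
    refine Fintype.sum_equiv (Equiv.mulRight π⁻¹) _ _ fun ρ =>
      Fintype.sum_equiv (Equiv.mulRight π⁻¹) _ _ fun τ => ?_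
    exact Fintype.prod_equiv π _ _ fun r => by simp
  have hk : (k ! : ℂ) ≠ 0 := by exact_mod_cast k.factorial_ne_zero
  rw [compress_apply, SymPow.inner_def, hval]
  simp only [eQ, symTensor, tensorSymm, LinearMap.smul_apply, LinearMap.sum_apply, map_smul,
    map_sum, PiTensorProduct.map_tprod, tensorInner_smul_left, tensorInner_smul_right,
    tensorInner_sum_left, tensorInner_sum_right, tensorInner_tprod, inner_op,
    Complex.star_def, Complex.conj_ofReal]
  simp only [← Finset.mul_sum]
  -- The sum over the permutations of the operators is moved outermost.
  rw [Finset.sum_comm, Finset.sum_congr rfl fun π _ => hπ π]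
  simp only [Finset.sum_const, Finset.card_univ, Fintype.card_perm, Fintype.card_fin,
    nsmul_eq_mul]
  rw [mul_left_comm _ (k ! : ℂ), inv_mul_cancel_left₀ hk, ← mul_assoc,
    inv_sqrt_factorial_mul_self]

theorem compress_symPowOp_apply (e : OrthonormalBasis (Fin n) ℂ H)
    (X : Matrix (Fin n) (Fin n) ℂ) (I J : Q k n) :
    compress e (symPowOp k (op e X)) I J = (X.submatrix I.tuple J.tuple).permanent := by
  have hk : (k ! : ℂ) ≠ 0 := by exact_mod_cast k.factorial_ne_zero
  rw [symPowOp_eq_symOp, compress_symOp_apply e (fun _ => X)]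
  have := sum_perm_sum_perm_prod (X.submatrix I.tuple J.tuple)
  simp only [Matrix.submatrix_apply] at this
  rw [this, inv_mul_cancel_left₀ hk]

/-- The `e_I` are orthonormal: their Gram matrix consists of the permanents of the submatrices of
the identity matrix. -/
theorem inner_eQ (e : OrthonormalBasis (Fin n) ℂ H) (I J : Q k n) :
    ⟪eQ e I, eQ e J⟫_ℂ = if I = J then 1 else 0 := by
  have h := compress_symPowOp_apply e (1 : Matrix (Fin n) (Fin n) ℂ) I J
  rw [compress_apply, op, Matrix.toLin_one, symPowOp_id, LinearMap.id_apply] at h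
  rw [h]
  split_ifs with hIJ
  · subst hIJ
    rw [Matrix.submatrix_one _ I.tuple_injective, Matrix.permanent_one]
  -- If `J` has an entry outside `I`, the submatrix of the identity has a zero column.
  · obtain ⟨j, hj⟩ : ∃ j, J.tuple j ∉ I.1 := by
      by_contra! hcon
      refine hIJ (Subtype.ext (Finset.eq_of_subset_of_card_le ?_ (I.2.trans J.2.symm).le).symm)
      intro i hi
      obtain ⟨j, rfl⟩ : i ∈ Set.range J.tuple := by rwa [J.range_tuple]
      exact hcon j
    refine Finset.sum_eq_zero fun σ _ => Finset.prod_eq_zero (Finset.mem_univ j) ?_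
    refine Matrix.one_apply_ne fun heq => hj ?_
    rw [← heq]
    exact I.tuple_mem _

/-- Every matrix is the compression of some operator. -/
theorem exists_compress_eq (e : OrthonormalBasis (Fin n) ℂ H) (B : Matrix (Q k n) (Q k n) ℂ) :
    ∃ T, compress e T = B := by
  refine ⟨∑ I, ∑ J, B I J • ((innerₛₗ ℂ (eQ e J)).smulRight (eQ e I)), ?_⟩
  ext I J
  rw [compress_apply]
  simp [LinearMap.sum_apply, inner_eQ, Finset.sum_ite_eq]

end Compression

/-! ### The derivative as a trace -/

section Trace

variable {k n : ℕ} {H : Type*} [NormedAddCommGroup H] [InnerProductSpace ℂ H]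
  [FiniteDimensional ℂ H]

/-- Written out in coordinates, the trace is the sum over minors of
`iteratedFDeriv_permanent_eq_sum_minors`; the factor `k!` cancels the normalization of `∨`. -/
theorem iteratedFDeriv_permanent_eq_trace (e : OrthonormalBasis (Fin n) ℂ H)
    {A : Matrix (Fin n) (Fin n) ℂ} {ι : Q k n ≃ Q (n - k) n}
    {T : SymPow (n - k) H →ₗ[ℂ] SymPow (n - k) H} (hT : IsPermMinorOp e ι A T)
    (X : Fin k → Matrix (Fin n) (Fin n) ℂ) :
    iteratedFDeriv ℂ k (fun M : Matrix (Fin n) (Fin n) ℂ => M.permanent) A X =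
      (k ! : ℂ) * Matrix.trace ((compress e T).submatrix ι ι *
        compress e (symOp fun i => op e (X i))) := by
  have hk : (k ! : ℂ) ≠ 0 := by exact_mod_cast k.factorial_ne_zero
  have hT : (compress e T).submatrix ι ι = _ := hT
  rw [iteratedFDeriv_permanent_eq_sum_minors, hT]
  simp only [Matrix.trace, Matrix.diag_apply, Matrix.mul_apply, Matrix.transpose_apply,
    Matrix.of_apply, compress_symOp_apply, Finset.mul_sum (s := Finset.univ (α := Q k n))]
  refine Finset.sum_congr rfl fun J _ => Finset.sum_congr rfl fun I _ => ?_
  rw [mul_left_comm (k ! : ℂ), mul_inv_cancel_left₀ hk]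

theorem exists_isPermMinorOp (e : OrthonormalBasis (Fin n) ℂ H) (A : Matrix (Fin n) (Fin n) ℂ)
    (ι : Q k n ≃ Q (n - k) n) : ∃ T, IsPermMinorOp e ι A T := by
  obtain ⟨T, hT⟩ := exists_compress_eq e
    ((Matrix.of fun I J : Q k n => (deleted A I J).permanent).transpose.submatrix ι.symm ι.symm)
  refine ⟨T, ?_⟩
  rw [IsPermMinorOp, hT, Matrix.submatrix_submatrix, ι.symm_comp_self, Matrix.submatrix_id_id]

/-- The submatrix of `Aᵀ` with rows `Iᶜ` and columns `Jᶜ` is the transpose of `A(J|I)`, and the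
permanent is invariant under transposition. -/
theorem isPermMinorOp_symPowOp_transpose (hkn : k ≤ n) (e : OrthonormalBasis (Fin n) ℂ H)
    (A : Matrix (Fin n) (Fin n) ℂ) :
    IsPermMinorOp e (Q.complEquiv hkn) A (symPowOp (n - k) (op e A.transpose)) := by
  ext I J
  rw [Matrix.submatrix_apply, compress_symPowOp_apply, ← Matrix.transpose_submatrix,
    Matrix.permanent_transpose]
  rfl

/-- Singletons, as an equivalence of `Fin n` with `Q 1 n`. -/
def Q.singletonEquiv (n : ℕ) : Fin n ≃ Q 1 n :=
  Equiv.ofBijective (fun i => ⟨{i}, Finset.card_singleton i⟩)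
    ⟨fun _ _ h => Finset.singleton_injective (congrArg Subtype.val h), fun I =>
      let ⟨i, hi⟩ := Finset.card_eq_one.1 I.2
      ⟨i, Subtype.ext hi.symm⟩⟩

theorem Q.tuple_singletonEquiv (i : Fin n) (r : Fin 1) : (Q.singletonEquiv n i).tuple r = i :=
  Finset.mem_singleton.1 ((Q.singletonEquiv n i).tuple_mem r)

/-- The case `k = 1` of `iteratedFDeriv_permanent_eq_sum_minors`. -/
theorem fderiv_permanent (A X : Matrix (Fin n) (Fin n) ℂ) :
    fderiv ℂ (fun M : Matrix (Fin n) (Fin n) ℂ => M.permanent) A X =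
      Matrix.trace ((padj A).transpose * X) := by
  rw [← iteratedFDeriv_one_apply (𝕜 := ℂ) (fun _ : Fin 1 => X),
    iteratedFDeriv_permanent_eq_sum_minors, ← (Q.singletonEquiv n).sum_comp]
  simp only [Matrix.trace, Matrix.diag_apply, Matrix.mul_apply, Matrix.transpose_apply]
  refine Finset.sum_congr rfl fun j _ => ?_
  rw [← (Q.singletonEquiv n).sum_comp]
  refine Finset.sum_congr rfl fun i _ => ?_
  simp only [Q.tuple_singletonEquiv]
  simp only [padj, Matrix.of_apply, Finset.univ_unique, Finset.sum_const, Finset.card_singleton,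
    one_smul, Finset.prod_const, pow_one]
  rfl

end Trace

end PermDeriv

end

theorem theorem2p4 {n k : ℕ} (hk : 1 ≤ k) (hkn : k ≤ n)
    {H : Type*} [NormedAddCommGroup H] [InnerProductSpace ℂ H] [FiniteDimensional ℂ H]
    (e : OrthonormalBasis (Fin n) ℂ H) (A : Matrix (Fin n) (Fin n) ℂ) :
    -- the permanent is smooth, so that its derivatives are genuine
    ContDiff ℂ ∞ (fun M : Matrix (Fin n) (Fin n) ℂ => M.permanent) ∧
    -- the formula, for every operator that may be called `~∨^{n-k} A`
    (∀ (ι : PermDeriv.Q k n ≃ PermDeriv.Q (n - k) n)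
        (T : PermDeriv.SymPow (n - k) H →ₗ[ℂ] PermDeriv.SymPow (n - k) H),
      PermDeriv.IsPermMinorOp e ι A T →
      (∀ X : Fin k → Matrix (Fin n) (Fin n) ℂ,
        iteratedFDeriv ℂ k (fun M : Matrix (Fin n) (Fin n) ℂ => M.permanent) A X =
          (k ! : ℂ) * Matrix.trace ((PermDeriv.compress e T).submatrix ι ι *
            PermDeriv.compress e (PermDeriv.symOp fun i => PermDeriv.op e (X i)))) ∧
      (∀ X : Matrix (Fin n) (Fin n) ℂ,
        iteratedFDeriv ℂ k (fun M : Matrix (Fin n) (Fin n) ℂ => M.permanent) A (fun _ => X) =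
          (k ! : ℂ) * Matrix.trace ((PermDeriv.compress e T).submatrix ι ι *
            PermDeriv.compress e (PermDeriv.symPowOp k (PermDeriv.op e X))))) ∧
    -- such operators exist, whatever the identification of the index sets
    (∀ ι : PermDeriv.Q k n ≃ PermDeriv.Q (n - k) n, ∃ T, PermDeriv.IsPermMinorOp e ι A T) ∧
    -- if the index sets are identified through complements, `∨^{n-k} (Aᵀ)` is one
    PermDeriv.IsPermMinorOp e (PermDeriv.Q.complEquiv hkn) A
      (PermDeriv.symPowOp (n - k) (PermDeriv.op e A.transpose)) ∧
    -- the formula for the first derivative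
    (∀ X : Matrix (Fin n) (Fin n) ℂ,
      fderiv ℂ (fun M : Matrix (Fin n) (Fin n) ℂ => M.permanent) A X =
        Matrix.trace ((PermDeriv.padj A).transpose * X)) := by
  refine ⟨PermDeriv.contDiff_permanent, fun ι T hT => ⟨?_, fun X => ?_⟩,
    PermDeriv.exists_isPermMinorOp e A, PermDeriv.isPermMinorOp_symPowOp_transpose hkn e A,
    PermDeriv.fderiv_permanent A⟩
  · exact PermDeriv.iteratedFDeriv_permanent_eq_trace e hT
  · rw [PermDeriv.symPowOp_eq_symOp]
    exact PermDeriv.iteratedFDeriv_permanent_eq_trace e hT fun _ => X
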